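/- Let $\mathcal P_n$ be the set of real algebraic polynomials of degree at most $n$, and for $\alpha>-1$ let $$\|f\|_{w_\alpha}=\Big(\int_0^\infty |f(x)|^2\,x^{\alpha}e^{-x}\,dx\Big)^{1/2}$$ be the $L_2$-norm with the Laguerre weight $w_\alpha(x)=x^\alpha e^{-x}$. Let $$c_n(\alpha)=\sup_{p\in\mathcal P_n,\ p\ne 0}\frac{\|p'\|_{w_\alpha}}{\|p\|_{w_\alpha}}$$ be the best constant in the Markov inequality $\|p'\|_{w_\alpha}\le c_n(\alpha)\|p\|_{w_\alpha}$, $p\in\mathcal P_n$. Then for each fixed integer $n\ge 0$ the limit $\lim_{\alpha\to\infty}\alpha\,c_n^2(\alpha)$ exists and $$\frac{6n}{7}\le\lim_{\alpha\to\infty}\alpha\,c_n^2(\alpha)\le 3n .$$ -/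

import Mathlib

noncomputable section

/-- The Laguerre weight `w_α(x) = x ^ α * exp (-x)`, used on `(0, ∞)`. -/
def laguerreWeight (α x : ℝ) : ℝ := x ^ α * Real.exp (-x)

/-- The weighted norm `‖f‖_{w_α} = (∫₀^∞ |f(x)|² w_α(x) dx)^{1/2}`. -/
def laguerreNorm (α : ℝ) (f : ℝ → ℝ) : ℝ :=
  Real.sqrt (∫ x in Set.Ioi (0 : ℝ), |f x| ^ 2 * laguerreWeight α x)

/-- The best constant `c_n(α)` in the Markov inequality `‖p'‖_{w_α} ≤ c_n(α) ‖p‖_{w_α}`: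
the supremum of `‖p'‖_{w_α} / ‖p‖_{w_α}` over nonzero real polynomials `p` of degree
at most `n`. -/
def markovConst (n : ℕ) (α : ℝ) : ℝ :=
  sSup {r : ℝ | ∃ p : Polynomial ℝ, p ≠ 0 ∧ p.natDegree ≤ n ∧
    r = laguerreNorm α (fun x => p.derivative.eval x) / laguerreNorm α (fun x => p.eval x)}

end

open Polynomial

/-- The moment functional `∫₀^∞ p(x) x^β e^{-x} dx` on polynomials. -/
noncomputable def laguerreFunctional (β : ℝ) (p : ℝ[X]) : ℝ :=
  ∫ x in Set.Ioi (0 : ℝ), p.eval x * laguerreWeight β x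

namespace laguerreFunctional

theorem integrableOn_eval {β : ℝ} (hβ : -1 < β) (p : ℝ[X]) :
    MeasureTheory.IntegrableOn (fun x : ℝ => p.eval x * laguerreWeight β x) (Set.Ioi 0) := by
  induction p using Polynomial.induction_on' with
  | add p q hp hq =>
    simp only [eval_add, add_mul]
    exact hp.add hq
  | monomial k a =>
    have h : MeasureTheory.IntegrableOn
        (fun x : ℝ => a * (Real.exp (-x) * x ^ ((k : ℝ) + β + 1 - 1))) (Set.Ioi 0) :=
      (Real.GammaIntegral_convergent (by linarith [k.cast_nonneg (α := ℝ)])).const_mul a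
    refine h.congr_fun (fun x hx => ?_) measurableSet_Ioi
    have hx : (0 : ℝ) < x := hx
    simp only [laguerreWeight, eval_monomial]
    rw [add_sub_cancel_right, Real.rpow_add hx, Real.rpow_natCast]
    ring

theorem map_add {β : ℝ} (hβ : -1 < β) (p q : ℝ[X]) :
    laguerreFunctional β (p + q) = laguerreFunctional β p + laguerreFunctional β q := by
  simp only [laguerreFunctional, eval_add, add_mul]
  exact MeasureTheory.integral_add (integrableOn_eval hβ p) (integrableOn_eval hβ q)

theorem map_C_mul (β a : ℝ) (p : ℝ[X]) :
    laguerreFunctional β (C a * p) = a * laguerreFunctional β p := by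
  simp only [laguerreFunctional, eval_mul, eval_C, mul_assoc]
  exact MeasureTheory.integral_const_mul _ _

theorem map_sub {β : ℝ} (hβ : -1 < β) (p q : ℝ[X]) :
    laguerreFunctional β (p - q) = laguerreFunctional β p - laguerreFunctional β q := by
  have h := map_add hβ p (C (-1) * q)
  rw [map_C_mul] at h
  rw [show p - q = p + C (-1) * q by simp [sub_eq_add_neg], h]
  ring

theorem apply_monomial {β : ℝ} (hβ : -1 < β) (k : ℕ) (a : ℝ) :
    laguerreFunctional β (monomial k a) = a * Real.Gamma (k + β + 1) := by
  rw [Real.Gamma_eq_integral (by linarith [k.cast_nonneg (α := ℝ)]),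
    ← MeasureTheory.integral_const_mul]
  refine MeasureTheory.setIntegral_congr_fun measurableSet_Ioi (fun x hx => ?_)
  have hx : (0 : ℝ) < x := hx
  simp only [laguerreWeight, eval_monomial]
  rw [add_sub_cancel_right, Real.rpow_add hx, Real.rpow_natCast]
  ring

theorem X_mul (β : ℝ) (p : ℝ[X]) :
    laguerreFunctional β (X * p) = laguerreFunctional (β + 1) p := by
  refine MeasureTheory.setIntegral_congr_fun measurableSet_Ioi (fun x hx => ?_)
  have hx : (0 : ℝ) < x := hx
  simp only [laguerreWeight, eval_mul, eval_X]
  rw [Real.rpow_add hx, Real.rpow_one]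
  ring

/-- Integration by parts. -/
theorem apply_derivative {β : ℝ} (hβ : -1 < β) (p : ℝ[X]) :
    laguerreFunctional (β + 1) (derivative p) =
      laguerreFunctional (β + 1) p - (β + 1) * laguerreFunctional β p := by
  have hβ' : -1 < β + 1 := by linarith
  induction p using Polynomial.induction_on' with
  | add p q hp hq =>
    rw [derivative_add, map_add hβ', map_add hβ', map_add hβ, hp, hq]
    ring
  | monomial k a =>
    rw [derivative_monomial, apply_monomial hβ', apply_monomial hβ', apply_monomial hβ]
    have hpos : (0 : ℝ) < k + β + 1 := by linarith [k.cast_nonneg (α := ℝ)]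
    rw [show (k : ℝ) + (β + 1) + 1 = (k + β + 1) + 1 by ring, Real.Gamma_add_one hpos.ne']
    rcases k with _ | k
    · simp
      ring
    · simp only [Nat.add_sub_cancel]
      rw [show (k : ℝ) + (β + 1) + 1 = ((k + 1 : ℕ) : ℝ) + β + 1 by push_cast; ring]
      push_cast
      ring

theorem sq_nonneg (β : ℝ) (p : ℝ[X]) : 0 ≤ laguerreFunctional β (p ^ 2) := by
  refine MeasureTheory.setIntegral_nonneg measurableSet_Ioi (fun x hx => ?_)
  have hx : (0 : ℝ) < x := hx
  simp only [laguerreWeight, eval_pow]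
  positivity

theorem sq_pos {β : ℝ} (hβ : -1 < β) {p : ℝ[X]} (hp : p ≠ 0) :
    0 < laguerreFunctional β (p ^ 2) := by
  refine (sq_nonneg β p).lt_of_ne' fun h => ?_
  have h0 := (MeasureTheory.setIntegral_eq_zero_iff_of_nonneg_ae
    (MeasureTheory.ae_restrict_of_forall_mem measurableSet_Ioi (fun x hx => ?_))
    (integrableOn_eval hβ (p ^ 2))).1 h
  · have hroots : ∀ᵐ x ∂(MeasureTheory.volume.restrict (Set.Ioi (0 : ℝ))),
        x ∉ (p.roots.toFinset : Set ℝ) :=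
      MeasureTheory.ae_restrict_of_ae
        (MeasureTheory.measure_eq_zero_iff_ae_notMem.1 (Finset.measure_zero _ _))
    have hmem := MeasureTheory.ae_restrict_mem (μ := MeasureTheory.volume)
      (measurableSet_Ioi (a := (0 : ℝ)))
    have hfalse : ∀ᵐ x ∂(MeasureTheory.volume.restrict (Set.Ioi (0 : ℝ))), False := by
      filter_upwards [h0, hroots, hmem] with x h1 h2 h3
      have hx : (0 : ℝ) < x := h3
      have h4 : p.eval x ≠ 0 := by simpa [hp] using h2
      have h5 : 0 < (p ^ 2).eval x * laguerreWeight β x := by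
        simp only [laguerreWeight, eval_pow]
        positivity
      exact h5.ne' h1
    rw [MeasureTheory.ae_iff] at hfalse
    simp at hfalse
  · have hx : (0 : ℝ) < x := hx
    simp only [laguerreWeight, eval_pow, Pi.zero_apply]
    positivity

theorem laguerreNorm_eval (α : ℝ) (p : ℝ[X]) :
    laguerreNorm α (fun x => p.eval x) = √(laguerreFunctional α (p ^ 2)) := by
  simp only [laguerreNorm, laguerreFunctional, sq_abs, eval_pow]

end laguerreFunctional

/-- The Laguerre differential operator `u ↦ -(x u'' + (β + 1 - x) u')`. -/
noncomputable def laguerreOperator (β : ℝ) (u : ℝ[X]) : ℝ[X] :=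
  X * derivative u - C (β + 1) * derivative u - X * derivative (derivative u)

namespace laguerreFunctional

theorem laguerreOperator_mul {β : ℝ} (hβ : -1 < β) (u v : ℝ[X]) :
    laguerreFunctional β (laguerreOperator β u * v) =
      laguerreFunctional (β + 1) (derivative u * derivative v) := by
  have hβ' : -1 < β + 1 := by linarith
  have h := apply_derivative hβ (derivative u * v)
  rw [derivative_mul, map_add hβ'] at h
  rw [show laguerreOperator β u * v = X * (derivative u * v) - C (β + 1) * (derivative u * v) -
    X * (derivative (derivative u) * v) by rw [laguerreOperator]; ring, map_sub hβ, map_sub hβ,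
    X_mul, X_mul, map_C_mul]
  linarith

theorem derivative_laguerreOperator (β : ℝ) (u : ℝ[X]) :
    derivative (laguerreOperator β u) =
      laguerreOperator (β + 1) (derivative u) + derivative u := by
  simp only [laguerreOperator, derivative_sub, derivative_mul, derivative_X, derivative_C]
  simp only [C_add, C_1]
  ring

theorem derivative_sq_le (n : ℕ) {β : ℝ} (hβ : -1 < β) (u : ℝ[X]) (hu : u.natDegree ≤ n) :
    laguerreFunctional (β + 1) (derivative u ^ 2) ≤ n * laguerreFunctional β (u ^ 2) := by
  induction n generalizing β u with
  | zero =>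
    rw [derivative_of_natDegree_zero (by omega)]
    simp [laguerreFunctional]
  | succ n ih =>
    have hβ' : -1 < β + 1 := by linarith
    have hE := laguerreOperator_mul hβ u u
    have hL := laguerreOperator_mul hβ u (laguerreOperator β u)
    have hD := ih hβ' (derivative u) ((natDegree_derivative_le u).trans (by omega))
    have hD' := laguerreOperator_mul hβ' (derivative u) (derivative u)
    rw [derivative_laguerreOperator, mul_add, map_add hβ',
      mul_comm (derivative u) (laguerreOperator _ _), hD'] at hL
    have hsq := sq_nonneg β (laguerreOperator β u - C ((n : ℝ) + 1) * u)
    rw [show (laguerreOperator β u - C ((n : ℝ) + 1) * u) ^ 2 =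
      laguerreOperator β u * laguerreOperator β u -
        C (2 * ((n : ℝ) + 1)) * (laguerreOperator β u * u) + C (((n : ℝ) + 1) ^ 2) * u ^ 2 by
      simp only [C_mul, C_pow, C_ofNat]; ring, map_add hβ, map_sub hβ, map_C_mul, map_C_mul] at hsq
    simp only [← pow_two] at hE hL hD hsq
    rw [hE, hL] at hsq
    push_cast
    have hn : (0 : ℝ) < n + 1 := by positivity
    refine le_of_mul_le_mul_left ?_ hn
    nlinarith

theorem sub_derivative_sq {α : ℝ} (hα : 0 < α) (u : ℝ[X]) :
    laguerreFunctional α ((u - derivative u) ^ 2) =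
      α * laguerreFunctional (α - 1) (u ^ 2) + laguerreFunctional α (derivative u ^ 2) := by
  have hα' : -1 < α := by linarith
  have h := apply_derivative (β := α - 1) (by linarith) (u ^ 2)
  rw [sub_add_cancel] at h
  rw [show (u - derivative u) ^ 2 = u ^ 2 - derivative (u ^ 2) + derivative u ^ 2 by
    rw [derivative_sq, C_ofNat]; ring, map_add hα', map_sub hα', h]
  ring

theorem sub_sq {α : ℝ} (hα : -1 < α) (a b : ℝ[X]) (r : ℝ) :
    laguerreFunctional α ((C r * a - b) ^ 2) = r ^ 2 * laguerreFunctional α (a ^ 2) -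
      2 * r * laguerreFunctional α (a * b) + laguerreFunctional α (b ^ 2) := by
  rw [show (C r * a - b) ^ 2 = C (r ^ 2) * a ^ 2 - C (2 * r) * (a * b) + b ^ 2 by
    simp only [C_mul, C_pow, C_ofNat]; ring, map_add hα, map_sub hα, map_C_mul, map_C_mul]

theorem sub_sq_le {α t : ℝ} (hα : -1 < α) (ht : 0 < t) {a b : ℝ[X]}
    (hab : laguerreFunctional α (b ^ 2) ≤ t ^ 2 * laguerreFunctional α (a ^ 2)) :
    laguerreFunctional α ((a - b) ^ 2) ≤ (1 + t) ^ 2 * laguerreFunctional α (a ^ 2) := by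
  have h1 := sub_sq hα a b 1
  have h2 := sub_sq hα a b (-t)
  have h3 := sq_nonneg α (C (-t) * a - b)
  rw [C_1, one_mul] at h1
  rw [h2] at h3
  rw [h1]
  refine le_of_mul_le_mul_left ?_ ht
  nlinarith

theorem le_sub_sq {α t : ℝ} (hα : -1 < α) (ht : 0 < t) (ht1 : t ≤ 1) {a b : ℝ[X]}
    (hab : laguerreFunctional α (b ^ 2) ≤ t ^ 2 * laguerreFunctional α (a ^ 2)) :
    (1 - t) ^ 2 * laguerreFunctional α (a ^ 2) ≤ laguerreFunctional α ((a - b) ^ 2) := by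
  have h1 := sub_sq hα a b 1
  have h2 := sub_sq hα a b t
  have h3 := sq_nonneg α (C t * a - b)
  rw [C_1, one_mul] at h1
  rw [h2] at h3
  rw [h1]
  refine le_of_mul_le_mul_left ?_ ht
  nlinarith [mul_le_mul_of_nonneg_left hab (sub_nonneg.2 ht1)]

theorem derivative_sq_le_sub_derivative_sq {n : ℕ} {α : ℝ} (hα : 0 < α) {u : ℝ[X]}
    (hu : u.natDegree ≤ n) :
    laguerreFunctional α (derivative u ^ 2) ≤
      n / (n + α) * laguerreFunctional α ((u - derivative u) ^ 2) := by
  have h := derivative_sq_le n (β := α - 1) (by linarith) u hu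
  rw [sub_add_cancel] at h
  rw [sub_derivative_sq hα, div_mul_eq_mul_div, le_div_iff₀ (by positivity)]
  nlinarith

end laguerreFunctional

theorem exists_sub_derivative_eq (n : ℕ) (p : ℝ[X]) (hp : p.natDegree ≤ n) :
    ∃ u : ℝ[X], u.natDegree ≤ n ∧ u - derivative u = p := by
  induction n generalizing p with
  | zero => exact ⟨p, hp, by rw [derivative_of_natDegree_zero (by omega), sub_zero]⟩
  | succ n ih =>
    obtain ⟨v, hv, hvp⟩ := ih (derivative p) ((natDegree_derivative_le p).trans (by omega))
    refine ⟨p + v, (natDegree_add_le _ _).trans (max_le hp (hv.trans n.le_succ)), ?_⟩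
    rw [derivative_add, ← hvp]
    ring

/-- A Laguerre polynomial, normalised to take the value `1` at `0`. -/
theorem exists_laguerreOperator_eq (n : ℕ) {β : ℝ} (hβ : -1 < β) :
    ∃ u : ℝ[X], u ≠ 0 ∧ u.natDegree ≤ n ∧ laguerreOperator β u = C (n : ℝ) * u := by
  set a : ℕ → ℝ := fun k =>
    ∏ i ∈ Finset.range k, (-((n : ℝ) - i) / ((i + 1) * (i + 1 + β))) with ha
  have hsucc (k : ℕ) : (k + 1) * (k + 1 + β) * a (k + 1) = -((n : ℝ) - k) * a k := by
    have h1 : (0 : ℝ) < k + 1 + β := by linarith [k.cast_nonneg (α := ℝ)]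
    simp only [ha, Finset.prod_range_succ]
    field_simp
  have hzero (k : ℕ) (hk : n < k) : a k = 0 :=
    Finset.prod_eq_zero (Finset.mem_range.2 hk) (by simp)
  set u : ℝ[X] := ∑ k ∈ Finset.range (n + 1), monomial k (a k) with hu
  have hcoeff (k : ℕ) : u.coeff k = a k := by
    simp only [hu, finsetSum_coeff, coeff_monomial, Finset.sum_ite_eq', Finset.mem_range]
    split_ifs with h
    · rfl
    · exact (hzero k (by omega)).symm
  refine ⟨u, fun h => ?_, natDegree_le_iff_coeff_eq_zero.2 fun k hk => ?_, ?_⟩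
  · have := hcoeff 0
    simp [h, ha] at this
  · rw [hcoeff, hzero k hk]
  · ext k
    rw [laguerreOperator, coeff_sub, coeff_sub, coeff_C_mul, coeff_C_mul]
    rcases k with _ | k
    · have := hsucc 0
      simp only [coeff_X_mul_zero, coeff_derivative, hcoeff]
      push_cast at this ⊢
      linarith
    · have := hsucc (k + 1)
      simp only [coeff_X_mul, coeff_derivative, hcoeff]
      push_cast at this ⊢
      linarith

namespace laguerreFunctional

theorem derivative_sq_le_of_sq {n : ℕ} {α s t : ℝ} (hα : 0 < α) (ht : 0 < t)
    (hs : s ^ 2 = n / (n + α)) (hst : (1 + t) * s = t) (m : ℕ) (hm : m ≤ n) (p : ℝ[X])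
    (hp : p.natDegree ≤ m) :
    laguerreFunctional α (derivative p ^ 2) ≤ t ^ 2 * laguerreFunctional α (p ^ 2) := by
  induction m generalizing p with
  | zero =>
    rw [derivative_of_natDegree_zero (by omega)]
    have := mul_nonneg (_root_.sq_nonneg t) (sq_nonneg α p)
    simpa [laguerreFunctional] using this
  | succ m ih =>
    obtain ⟨u, hu, rfl⟩ := exists_sub_derivative_eq _ p hp
    have h1 := derivative_sq_le_sub_derivative_sq hα (hu.trans hm)
    have h2 := ih (by omega) (derivative u) ((natDegree_derivative_le u).trans (by omega))
    have h3 := sub_sq_le (by linarith) ht h2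
    rw [derivative_sub]
    refine h3.trans ((mul_le_mul_of_nonneg_left h1 (_root_.sq_nonneg _)).trans_eq ?_)
    rw [← hs, ← mul_assoc, ← mul_pow, hst]

end laguerreFunctional

open laguerreFunctional

theorem mem_upperBounds_markov {n : ℕ} {α s t : ℝ} (hα : 0 < α) (ht : 0 < t)
    (hs : s ^ 2 = n / (n + α)) (hst : (1 + t) * s = t) :
    t ∈ upperBounds {r : ℝ | ∃ p : ℝ[X], p ≠ 0 ∧ p.natDegree ≤ n ∧
      r = laguerreNorm α (fun x => p.derivative.eval x) /
        laguerreNorm α (fun x => p.eval x)} := by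
  rintro r ⟨p, -, hp, rfl⟩
  rw [laguerreNorm_eval, laguerreNorm_eval]
  refine div_le_of_le_mul₀ (Real.sqrt_nonneg _) ht.le (Real.sqrt_le_iff.2 ⟨by positivity, ?_⟩)
  rw [mul_pow, Real.sq_sqrt (sq_nonneg _ _)]
  exact derivative_sq_le_of_sq hα ht hs hst n le_rfl p hp

theorem markovConst_nonneg (n : ℕ) (α : ℝ) : 0 ≤ markovConst n α := by
  refine Real.sSup_nonneg ?_
  rintro r ⟨p, -, -, rfl⟩
  exact div_nonneg (Real.sqrt_nonneg _) (Real.sqrt_nonneg _)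

theorem markovConst_zero (α : ℝ) : markovConst 0 α = 0 := by
  refine le_antisymm (Real.sSup_le ?_ le_rfl) (markovConst_nonneg 0 α)
  rintro r ⟨p, -, hp, rfl⟩
  rw [derivative_of_natDegree_zero (by omega)]
  simp [laguerreNorm]

theorem markovConst_le {n : ℕ} {α s t : ℝ} (hα : 0 < α) (ht : 0 < t)
    (hs : s ^ 2 = n / (n + α)) (hst : (1 + t) * s = t) : markovConst n α ≤ t :=
  Real.sSup_le (fun _ hr => mem_upperBounds_markov hα ht hs hst hr) ht.le

theorem le_markovConst {n : ℕ} {α s t : ℝ} (hα : 0 < α) (ht : 0 < t) (ht1 : t ≤ 1)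
    (hs : s ^ 2 = n / (n + α)) (hst : (1 + t) * s = t) :
    (1 - t) * s ≤ markovConst n α := by
  have hα' : -1 < α := by linarith
  have hβ : -1 < α - 1 := by linarith
  obtain ⟨u, hu0, hun, hu⟩ := exists_laguerreOperator_eq n hβ
  have hpos := sq_pos hβ hu0
  have hE := laguerreOperator_mul hβ u u
  rw [hu, sub_add_cancel, mul_assoc, map_C_mul, ← pow_two, ← pow_two] at hE
  have hp := sub_derivative_sq hα u
  have hD := sq_nonneg α (derivative u)
  have hppos : 0 < laguerreFunctional α ((u - derivative u) ^ 2) := by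
    rw [hp]
    positivity
  have hp0 : u - derivative u ≠ 0 := by
    intro h
    simp [h, laguerreFunctional] at hppos
  have hdeg : (u - derivative u).natDegree ≤ n :=
    (natDegree_sub_le _ _).trans (max_le hun ((natDegree_derivative_le u).trans (by omega)))
  refine le_trans ?_ (le_csSup ⟨t, mem_upperBounds_markov hα ht hs hst⟩ ⟨_, hp0, hdeg, rfl⟩)
  rw [laguerreNorm_eval, laguerreNorm_eval, le_div_iff₀ (Real.sqrt_pos.2 hppos)]
  refine Real.le_sqrt_of_sq_le ?_
  have h1 := derivative_sq_le_of_sq hα ht hs hst n le_rfl (derivative u)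
    ((natDegree_derivative_le u).trans (by omega))
  have h2 := le_sub_sq hα' ht ht1 h1
  rw [mul_pow, Real.sq_sqrt hppos.le, mul_pow, hs, mul_assoc, derivative_sub]
  convert h2 using 2
  rw [hp, ← hE]
  have : (n : ℝ) + α ≠ 0 := by positivity
  field_simp
  ring

theorem tendsto_mul_markovConst_sq {n : ℕ} (hn : 0 < n) :
    Filter.Tendsto (fun α : ℝ => α * markovConst n α ^ 2) Filter.atTop (nhds (n : ℝ)) := by
  have hn' : (0 : ℝ) < n := by exact_mod_cast hn
  set s : ℝ → ℝ := fun α => √(n / (n + α)) with hsdef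
  set t : ℝ → ℝ := fun α => s α / (1 - s α) with htdef
  have hq : Filter.Tendsto (fun α : ℝ => (n : ℝ) / (n + α)) Filter.atTop (nhds 0) :=
    (Filter.tendsto_atTop_add_const_left _ _ Filter.tendsto_id).const_div_atTop _
  have hs : Filter.Tendsto s Filter.atTop (nhds 0) := by
    simpa only [Real.sqrt_zero] using hq.sqrt
  have ht : Filter.Tendsto t Filter.atTop (nhds 0) := by
    have h := hs.div ((tendsto_const_nhds (x := (1 : ℝ))).sub hs) (by norm_num)
    rwa [zero_div] at h
  have hαs : Filter.Tendsto (fun α : ℝ => α * s α ^ 2) Filter.atTop (nhds (n : ℝ)) := by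
    have h : Filter.Tendsto (fun α : ℝ => (n : ℝ) * (1 - n / (n + α))) Filter.atTop (nhds (n : ℝ)) := by
      simpa using (tendsto_const_nhds (x := (1 : ℝ)).sub hq).const_mul (n : ℝ)
    refine h.congr' ?_
    filter_upwards [Filter.eventually_gt_atTop 0] with α hα
    rw [hsdef]
    dsimp only
    rw [Real.sq_sqrt (by positivity)]
    field_simp
    ring
  have hlow : Filter.Tendsto (fun α : ℝ => (1 - t α) ^ 2 * (α * s α ^ 2)) Filter.atTop
      (nhds (n : ℝ)) := by
    simpa using ((tendsto_const_nhds (x := (1 : ℝ)).sub ht).pow 2).mul hαs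
  have hup : Filter.Tendsto (fun α : ℝ => (1 + t α) ^ 2 * (α * s α ^ 2)) Filter.atTop
      (nhds (n : ℝ)) := by
    simpa using ((tendsto_const_nhds (x := (1 : ℝ)).add ht).pow 2).mul hαs
  have key : ∀ᶠ α : ℝ in Filter.atTop, 0 < α ∧ 0 < t α ∧ t α ≤ 1 ∧ 0 ≤ s α ∧
      s α ^ 2 = n / (n + α) ∧ (1 + t α) * s α = t α := by
    filter_upwards [Filter.eventually_gt_atTop 0, hs.eventually_lt_const zero_lt_one,
      ht.eventually_lt_const zero_lt_one] with α hα hs1 ht1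
    have hs0 : 0 < s α := Real.sqrt_pos.2 (by positivity)
    have h1 : 0 < 1 - s α := by linarith
    refine ⟨hα, div_pos hs0 h1, ht1.le, hs0.le, Real.sq_sqrt (by positivity), ?_⟩
    simp only [htdef]
    field_simp
    ring
  refine tendsto_of_tendsto_of_tendsto_of_le_of_le' hlow hup ?_ ?_
  · filter_upwards [key] with α ⟨hα, h0, h1, hs0, hs, hst⟩
    have h := le_markovConst hα h0 h1 hs hst
    have := pow_le_pow_left₀ (mul_nonneg (sub_nonneg.2 h1) hs0) h 2
    nlinarith [mul_le_mul_of_nonneg_left this hα.le]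
  · filter_upwards [key] with α ⟨hα, h0, h1, hs0, hs, hst⟩
    have h := markovConst_le hα h0 hs hst
    rw [← hst] at h
    have := pow_le_pow_left₀ (markovConst_nonneg n α) h 2
    nlinarith [mul_le_mul_of_nonneg_left this hα.le]

theorem corollary1p4 (n : ℕ) :
    ∃ L : ℝ,
      Filter.Tendsto (fun α : ℝ => α * markovConst n α ^ 2) Filter.atTop (nhds L) ∧
        6 * (n : ℝ) / 7 ≤ L ∧ L ≤ 3 * (n : ℝ) := by
  have hn : (0 : ℝ) ≤ n := n.cast_nonneg
  refine ⟨n, ?_, by linarith, by linarith⟩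
  rcases n.eq_zero_or_pos with rfl | h
  · simp [markovConst_zero]
  · exact tendsto_mul_markovConst_sq h
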